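/- Let $q$ be a prime power and let $t,n_1,\dots,n_t,m_1,\dots,m_t$ be positive integers with $m_1\ge\dots\ge m_t$ and $m_i\ge n_i$ for all $i\in[t]=\{1,\dots,t\}$. Put $n=n_1+\dots+n_t$ and $\mathbb M=\mathbb F_q^{m_1\times n_1}\times\dots\times\mathbb F_q^{m_t\times n_t}$. For $C=(C_1,\dots,C_t)\in\mathbb M$ let $\mathrm{srk}(C)=\sum_{i=1}^t\mathrm{rk}(C_i)$. A code is an $\mathbb F_q$-linear subspace of $\mathbb M$; the minimum distance of a code $\mathcal C\neq 0$ is $d(\mathcal C)=\min\{\mathrm{srk}(C): C\in\mathcal C\setminus 0\}$. A nonzero code $\mathcal C$ is MSRD (maximum sum-rank distance) if there are $k\in[t]$ and $0\le\varepsilon\le n_k-1$ with $d(\mathcal C)=\sum_{i=1}^{k-1}n_i+\varepsilon+1$ and $\dim_{\mathbb F_q}(\mathcal C)=\sum_{i=k}^t m_in_i-\varepsilon m_k$. Let $j=\min\{i\in[t]: m_i=m_t\}$, let $0\le\delta\le n_j-1$, and let $d=\sum_{i=1}^{j-1}n_i+\delta+1$. Suppose that the set $\{i\in[t]: n_i>m_t\}$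 is non-empty, let $h$ be its maximum, and assume that $$m_h\ge m_t\left(\sum_{i=j}^t n_i-\delta\right)\quad\text{and}\quad q>t-h.$$ Then there exist MSRD codes $\mathcal C_n\subseteq\dots\subseteq\mathcal C_{d+1}\subseteq\mathcal C_d\subseteq\mathbb M$ with $d(\mathcal C_i)=i$ for all $d\le i\le n$. -/

import Mathlib

/-- The ambient space `F^{m₁ × n₁} × ⋯ × F^{m_t × n_t}`; the blocks are indexed by `Fin t`. -/
abbrev MatTuple (F : Type*) {t : ℕ} (m n : Fin t → ℕ) : Type _ :=
  (i : Fin t) → Matrix (Fin (m i)) (Fin (n i)) F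

/-- The sum-rank weight: the sum of the ranks of the components. -/
noncomputable def srk {F : Type*} [Field F] {t : ℕ} {m n : Fin t → ℕ}
    (X : MatTuple F m n) : ℕ :=
  ∑ i, (X i).rank

/-- The minimum distance of a nonzero linear sum-rank metric code: the least sum-rank weight of
a nonzero codeword. (The zero code has no minimum distance; here it gets the value `0`, which is
not attained by any nonzero code.) -/
noncomputable def minDist {F : Type*} [Field F] {t : ℕ} {m n : Fin t → ℕ}
    (C : Submodule F (MatTuple F m n)) : ℕ :=
  sInf {w | ∃ X ∈ C, X ≠ 0 ∧ srk X = w}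

/-- A nonzero linear code `C` is maximum sum-rank distance (MSRD) if for some block `j` and some
`0 ≤ δ ≤ n_j - 1` its minimum distance is `∑_{i < j} n_i + δ + 1` and its dimension over `F` is
`∑_{i ≥ j} m_i n_i - δ m_j`. (The subtraction is written as an addition on the other side.) -/
def IsMSRD {F : Type*} [Field F] {t : ℕ} {m n : Fin t → ℕ}
    (C : Submodule F (MatTuple F m n)) : Prop :=
  C ≠ ⊥ ∧ ∃ (j : Fin t) (δ : ℕ), δ < n j ∧
    minDist C = (∑ i ∈ Finset.Iio j, n i) + δ + 1 ∧
    Module.finrank F C + δ * m j = ∑ i ∈ Finset.Ici j, m i * n i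

/-! Put `μ = m_t`, let `K` be the extension of `F` of degree `μ`, `σ` its Frobenius, and `N = n - d
+ 1`. Messages are the vectors of `K^N`, read as skew polynomials `f` of degree less than `N`. A
block after `h` has `n_i ≤ μ ≤ m_i`. It carries `f` evaluated at the operator `x ↦ a_i σ(x)` on `K`,
restricted to an `n_i`-dimensional subspace. The `a_i` have distinct nonzero norms, available
because `q` exceeds the number of these blocks. By `sum_finrank_ker_skewEval_le` a nonzero `f` loses
total rank at most `deg f` there. A block up to `h` may be wider than `μ`, but `m_i ≥ μN = dim_F
K^N`. Messages therefore embed in the field of degree `m_i` and act by multiplication, with no loss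
of rank (`exists_linearMap_matrix_rank_eq`). Hence the sum-rank weight of the image of `f` is at
least `n - deg f` (`exists_sumRank_encoder`). The code `C_i` is the image of the polynomials of
degree at most `n - i`. These codes are nested, of dimension `μ(n - i + 1)` and distance at least
`i`; the Singleton argument `exists_srk_add_card_le` gives equality. -/

open Module

/-! ### Matrix families from linear operators -/

/-- A vector space embeds linearly into any vector space of at least its dimension. -/
theorem exists_injective_linearMap_of_finrank_le {F V W : Type*} [Field F] [AddCommGroup V]
    [Module F V] [AddCommGroup W] [Module F W] [FiniteDimensional F V] [FiniteDimensional F W]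
    (h : finrank F V ≤ finrank F W) : ∃ f : V →ₗ[F] W, Function.Injective f := by
  obtain ⟨w, hw⟩ := exists_linearIndependent_of_le_finrank h
  refine ⟨(Fintype.linearCombination F w) ∘ₗ (finBasis F V).equivFun.toLinearMap, ?_⟩
  rw [LinearMap.coe_comp]
  exact hw.fintypeLinearCombination_injective.comp (finBasis F V).equivFun.injective

/-- `D` maps the kernel of `G * D` into that of `G`, and what it kills lies in its own kernel;
rank-nullity adds the two. -/
theorem finrank_ker_mul_le {F V : Type*} [Field F] [AddCommGroup V] [Module F V]
    [FiniteDimensional F V] (G D : End F V) :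
    finrank F (LinearMap.ker (G * D)) ≤ finrank F (LinearMap.ker G) + finrank F (LinearMap.ker D) := by
  set P := LinearMap.ker (G * D)
  rw [← (D.domRestrict P).finrank_range_add_finrank_ker]
  refine add_le_add (Submodule.finrank_mono ?_) ?_
  · rintro _ ⟨⟨x, hx⟩, rfl⟩
    exact hx
  · refine LinearMap.finrank_le_finrank_of_injective
      (f := (P.subtype.restrict (p := LinearMap.ker (D.domRestrict P)) (q := LinearMap.ker D)
        fun x hx ↦ hx)) ?_
    intro x y hxy
    have h : ((x : P) : V) = ((y : P) : V) := congrArg (fun z : LinearMap.ker D ↦ (z : V)) hxy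
    exact Subtype.ext (Subtype.ext h)

/-- A linear family of endomorphisms of a space of dimension at least `n` and at most `M` yields a
linear family of `M × n` matrices whose rank defects are bounded by the nullities. -/
theorem exists_linearMap_matrix_rank {F V K : Type*} [Field F] [AddCommGroup V] [Module F V]
    [AddCommGroup K] [Module F K] [FiniteDimensional F K] (Φ : V →ₗ[F] End F K) {M n : ℕ}
    (hn : n ≤ finrank F K) (hM : finrank F K ≤ M) :
    ∃ φ : V →ₗ[F] Matrix (Fin M) (Fin n) F,
      ∀ v, n ≤ (φ v).rank + finrank F (LinearMap.ker (Φ v)) := by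
  obtain ⟨B, hB⟩ := exists_injective_linearMap_of_finrank_le (F := F) (V := Fin n → F) (W := K)
    (by simpa using hn)
  obtain ⟨e, he⟩ := exists_injective_linearMap_of_finrank_le (F := F) (V := K) (W := Fin M → F)
    (by simpa using hM)
  refine ⟨{ toFun := fun v ↦ LinearMap.toMatrix' (e ∘ₗ Φ v ∘ₗ B)
            map_add' := fun v w ↦ by
              simp [LinearMap.add_comp, LinearMap.comp_add]
            map_smul' := fun c v ↦ by
              simp [LinearMap.smul_comp, LinearMap.comp_smul] }, fun v ↦ ?_⟩
  change n ≤ (LinearMap.toMatrix' (e ∘ₗ Φ v ∘ₗ B)).rank + _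
  rw [Matrix.rank, ← Matrix.toLin'_apply', Matrix.toLin'_toMatrix']
  have h := (e ∘ₗ Φ v ∘ₗ B).finrank_range_add_finrank_ker
  rw [finrank_fin_fun] at h
  have hk : finrank F (LinearMap.ker (e ∘ₗ Φ v ∘ₗ B)) ≤ finrank F (LinearMap.ker (Φ v)) := by
    refine LinearMap.finrank_le_finrank_of_injective
      (f := B.restrict (p := LinearMap.ker (e ∘ₗ Φ v ∘ₗ B)) (q := LinearMap.ker (Φ v)) ?_) ?_
    · intro x hx
      have hx' : e (Φ v (B x)) = 0 := hx
      exact he (hx'.trans (map_zero e).symm)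
    · intro x y hxy
      exact Subtype.ext (hB (congrArg Subtype.val hxy))
  omega

theorem FiniteField.exists_extension_finrank_eq (F : Type*) [Field F] [Finite F] {n : ℕ}
    (hn : 0 < n) : ∃ (K : Type) (_ : Field K) (_ : Algebra F K) (_ : Finite K)
      (_ : FiniteDimensional F K), finrank F K = n := by
  obtain ⟨p, hp⟩ := CharP.exists F
  have : Fact p.Prime := ⟨CharP.char_is_prime F p⟩
  have : NeZero n := ⟨hn.ne'⟩
  exact ⟨FiniteField.Extension F p n, inferInstance, inferInstance, inferInstance, inferInstance,
    FiniteField.finrank_extension F p n⟩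

/-- Linear spaces of full-rank matrices of the maximal dimension `M`. -/
theorem exists_linearMap_matrix_rank_eq {F V : Type*} [Field F] [Finite F] [AddCommGroup V]
    [Module F V] [FiniteDimensional F V] {M n : ℕ} (hM : 0 < M) (hn : n ≤ M)
    (hV : finrank F V ≤ M) :
    ∃ φ : V →ₗ[F] Matrix (Fin M) (Fin n) F, ∀ v, v ≠ 0 → n ≤ (φ v).rank := by
  obtain ⟨K, _, _, _, _, hK⟩ := FiniteField.exists_extension_finrank_eq F hM
  obtain ⟨i, hi⟩ := exists_injective_linearMap_of_finrank_le (F := F) (V := V) (W := K)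
    (hK.symm ▸ hV)
  -- Multiplication by a nonzero element of the field `K` is injective, so the nullity is zero.
  obtain ⟨φ, hφ⟩ := exists_linearMap_matrix_rank ((Algebra.lmul F K).toLinearMap ∘ₗ i)
    (hK.symm ▸ hn) hK.le
  refine ⟨φ, fun v hv ↦ ?_⟩
  have hv' : i v ≠ 0 := fun h ↦ hv (hi (h.trans (map_zero i).symm))
  have hker : LinearMap.ker (((Algebra.lmul F K).toLinearMap ∘ₗ i) v) = ⊥ := by
    rw [LinearMap.ker_eq_bot']
    intro x hx
    exact (mul_eq_zero.mp (show i v * x = 0 from hx)).resolve_left hv'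
  have h := hφ v
  rwa [hker, finrank_bot, add_zero] at h

/-! ### Roots of skew polynomials -/

section SkewEvaluation

variable {F K : Type*} [Field F] [Field K] [Algebra F K]

/-- The semilinear operator `x ↦ a * σ x`. -/
noncomputable def skewShift (σ : K ≃ₐ[F] K) (a : K) : End F K :=
  Algebra.lmul F K a * σ.toLinearMap

/-- The operator obtained by evaluating the skew polynomial `∑_{k < s} f_k x^k` at `skewShift σ a`. -/
noncomputable def skewEval (σ : K ≃ₐ[F] K) (a : K) (f : ℕ → K) (s : ℕ) : End F K :=
  ∑ k ∈ Finset.range s, Algebra.lmul F K (f k) * skewShift σ a ^ k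

theorem skewShift_apply (σ : K ≃ₐ[F] K) (a x : K) : skewShift σ a x = a * σ x := rfl

theorem skewShift_pow_mul_lmul (σ : K ≃ₐ[F] K) (a b : K) (k : ℕ) :
    skewShift σ a ^ k * Algebra.lmul F K b = Algebra.lmul F K ((σ ^ k) b) * skewShift σ a ^ k := by
  induction k generalizing b with
  | zero => simp
  | succ k ih =>
    have h1 : skewShift σ a * Algebra.lmul F K b = Algebra.lmul F K (σ b) * skewShift σ a := by
      ext x
      simp [skewShift_apply]
      ring
    rw [pow_succ, mul_assoc, h1, ← mul_assoc, ih, mul_assoc, pow_succ σ]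
    rfl

/-- Right division by `x - b`, simultaneously in all evaluations. -/
theorem exists_skewEval_eq_mul_add (σ : K ≃ₐ[F] K) (b : K) (s : ℕ) (f : ℕ → K) :
    ∃ (g : ℕ → K) (c : K), (∀ r, r + 1 = s → g r = f s) ∧ ∀ a, skewEval σ a f (s + 1) =
      skewEval σ a g s * (skewShift σ a - Algebra.lmul F K b) + Algebra.lmul F K c := by
  induction s generalizing f with
  | zero => exact ⟨0, f 0, by simp, fun a ↦ by simp [skewEval]⟩
  | succ s ih =>
    -- The top term equals `f_{s+1} x^s (x - b) + f_{s+1} σ^s(b) x^s`; its second summand is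
    -- absorbed into the coefficient of `x^s`.
    obtain ⟨g, c, -, h⟩ := ih (Function.update f s (f s + f (s + 1) * (σ ^ s) b))
    refine ⟨Function.update g s (f (s + 1)), c, fun r hr ↦ ?_, fun a ↦ ?_⟩
    · obtain rfl : r = s := by omega
      simp
    · have e1 : ∀ (u : ℕ → K) (z : K), skewEval σ a (Function.update u s z) (s + 1) =
          skewEval σ a u s + Algebra.lmul F K z * skewShift σ a ^ s := by
        intro u z
        rw [skewEval, Finset.sum_range_succ, Function.update_self]
        congr 1
        refine Finset.sum_congr rfl fun k hk ↦ ?_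
        rw [Function.update_of_ne (Finset.mem_range.mp hk).ne]
      have e2 : skewEval σ a f (s + 1 + 1) = skewEval σ a f s +
          Algebra.lmul F K (f s) * skewShift σ a ^ s +
          Algebra.lmul F K (f (s + 1)) * skewShift σ a ^ (s + 1) := by
        rw [skewEval, Finset.sum_range_succ, Finset.sum_range_succ, skewEval]
      have h' := h a
      rw [e1, map_add, map_mul] at h'
      rw [e1, e2, add_mul, eq_sub_of_add_eq h'.symm, mul_assoc _ (skewShift σ a ^ s), mul_sub,
        ← pow_succ, skewShift_pow_mul_lmul]
      simp only [add_mul, mul_sub, mul_assoc]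
      abel

/-- The ratio of two nonzero solutions of `a σ(x) = b x` is fixed by `σ`, hence lies in `F`. -/
theorem finrank_ker_skewShift_sub_le_one [FiniteDimensional F K] (σ : K ≃ₐ[F] K)
    (hσ : ∀ x, σ x = x → x ∈ Set.range (algebraMap F K)) {a b : K} (ha : a ≠ 0) :
    finrank F (LinearMap.ker (skewShift σ a - Algebra.lmul F K b)) ≤ 1 := by
  by_cases hbot : LinearMap.ker (skewShift σ a - Algebra.lmul F K b) = ⊥
  · rw [hbot, finrank_bot]
    exact zero_le_one
  obtain ⟨y, hy, hy0⟩ := Submodule.exists_mem_ne_zero_of_ne_bot hbot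
  have key : ∀ x, x ∈ LinearMap.ker (skewShift σ a - Algebra.lmul F K b) → a * σ x = b * x :=
    fun x hx ↦ sub_eq_zero.mp hx
  refine finrank_le_one ⟨y, hy⟩ fun ⟨x, hx⟩ ↦ ?_
  have hσy : σ y ≠ 0 := by simpa using hy0
  obtain ⟨c, hc⟩ := hσ (x / y) (by
    rw [map_div₀, div_eq_div_iff hσy hy0]
    apply mul_left_cancel₀ ha
    calc a * (σ x * y) = (a * σ x) * y := by ring
      _ = x * (a * σ y) := by rw [key x hx, key y hy]; ring
      _ = a * (x * σ y) := by ring)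
  refine ⟨c, Subtype.ext ?_⟩
  change c • y = x
  rw [Algebra.smul_def, hc, div_mul_cancel₀ _ hy0]

/-- A skew polynomial of degree `s` has, on distinct conjugacy classes, root spaces of total
dimension at most `s`. -/
theorem sum_finrank_ker_skewEval_le [FiniteDimensional F K] (σ : K ≃ₐ[F] K)
    (hσ : ∀ x, σ x = x → x ∈ Set.range (algebraMap F K)) {ι : Type*} [Fintype ι] (a : ι → K)
    (ha : ∀ i, a i ≠ 0) (hinj : Function.Injective fun i ↦ Algebra.norm F (a i))
    (s : ℕ) (f : ℕ → K) (hf : f s ≠ 0) :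
    ∑ i, finrank F (LinearMap.ker (skewEval σ (a i) f (s + 1))) ≤ s := by
  classical
  induction s generalizing f with
  | zero =>
    refine (Finset.sum_eq_zero fun i _ ↦ ?_).le
    have : LinearMap.ker (skewEval σ (a i) f (0 + 1)) = ⊥ := by
      rw [LinearMap.ker_eq_bot']
      intro x hx
      have hx' : f 0 * x = 0 := by simpa [skewEval] using hx
      exact (mul_eq_zero.mp hx').resolve_left hf
    rw [this, finrank_bot]
  | succ s ih =>
    by_cases hall : ∀ i, LinearMap.ker (skewEval σ (a i) f (s + 1 + 1)) = ⊥
    · exact (Finset.sum_eq_zero fun i _ ↦ by rw [hall i, finrank_bot]).trans_le (Nat.zero_le _)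
    push Not at hall
    obtain ⟨i₁, hi₁⟩ := hall
    obtain ⟨y, hy, hy0⟩ := Submodule.exists_mem_ne_zero_of_ne_bot hi₁
    have hσy : σ y ≠ 0 := by simpa using hy0
    -- This `b` makes `y` a root of the factor `x - b` at `a i₁`, so the remainder of the division
    -- by it vanishes.
    set b := a i₁ * σ y / y with hb
    have norm_σ : ∀ x, Algebra.norm F (σ x) = Algebra.norm F x := fun x ↦
      (Algebra.norm_eq_of_algEquiv σ x)
    obtain ⟨g, c, hg, hdiv⟩ := exists_skewEval_eq_mul_add σ b (s + 1) f
    have hc : c = 0 := by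
      have h1 := LinearMap.mem_ker.mp hy
      rw [hdiv] at h1
      have h2 : (skewShift σ (a i₁) - Algebra.lmul F K b) y = 0 := by
        simp [skewShift_apply, hb, hy0]
      rw [LinearMap.add_apply, Module.End.mul_apply, h2, map_zero, zero_add] at h1
      exact (mul_eq_zero.mp h1).resolve_right hy0
    -- Splitting off `x - b` costs at most one dimension, and only at `i₁`: a root at another `i`
    -- would give `a i` the norm of `b`, which is that of `a i₁`.
    have hbound : ∀ i, finrank F (LinearMap.ker (skewEval σ (a i) f (s + 1 + 1))) ≤
        finrank F (LinearMap.ker (skewEval σ (a i) g (s + 1))) + if i = i₁ then 1 else 0 := by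
      intro i
      rw [hdiv, hc, map_zero, add_zero]
      refine (finrank_ker_mul_le _ _).trans (Nat.add_le_add_left ?_ _)
      split_ifs with hi
      · exact finrank_ker_skewShift_sub_le_one σ hσ (ha i)
      · have : LinearMap.ker (skewShift σ (a i) - Algebra.lmul F K b) = ⊥ := by
          rw [LinearMap.ker_eq_bot']
          intro x hx
          by_contra hx0
          have hx' : a i * σ x = b * x := sub_eq_zero.mp hx
          have h3 := congrArg (Algebra.norm F) hx'
          have h4 : Algebra.norm F b = Algebra.norm F (a i₁) := by
            have := congrArg (Algebra.norm F) (show b * y = a i₁ * σ y by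
              rw [hb, div_mul_cancel₀ _ hy0])
            rw [map_mul, map_mul, norm_σ] at this
            exact mul_right_cancel₀ (Algebra.norm_ne_zero_iff.mpr hy0) this
          rw [map_mul, map_mul, norm_σ, h4] at h3
          exact hi (hinj (mul_right_cancel₀ (Algebra.norm_ne_zero_iff.mpr hx0) h3))
        rw [this, finrank_bot]
    calc _ ≤ ∑ i, (finrank F (LinearMap.ker (skewEval σ (a i) g (s + 1))) +
          if i = i₁ then 1 else 0) := Finset.sum_le_sum fun i _ ↦ hbound i
      _ = ∑ i, finrank F (LinearMap.ker (skewEval σ (a i) g (s + 1))) + 1 := by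
        rw [Finset.sum_add_distrib]; simp
      _ ≤ s + 1 := Nat.add_le_add_right (ih g (by rwa [hg s rfl])) 1

end SkewEvaluation

/-! ### The encoder -/

theorem FiniteField.mem_range_algebraMap_of_frobenius_eq {F K : Type*} [Field F] [Fintype F]
    [Field K] [Algebra F K] [Finite K] {x : K}
    (hx : frobeniusAlgEquivOfAlgebraic F K x = x) : x ∈ Set.range (algebraMap F K) := by
  have : FiniteDimensional F K := .of_finite
  rw [IsGalois.mem_range_algebraMap_iff_fixed]
  intro g
  -- The Galois group consists of the powers of Frobenius.
  obtain ⟨k, rfl⟩ := (bijective_frobeniusAlgEquivOfAlgebraic_pow F K).2 g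
  change (frobeniusAlgEquivOfAlgebraic F K ^ (k : ℕ)) x = x
  rw [AlgEquiv.coe_pow]
  exact Function.iterate_fixed hx _

/-- The `F`-linear dependence of a skew evaluation on the coefficients. -/
noncomputable def skewEvalLinear {F K : Type*} [Field F] [Field K] [Algebra F K]
    (σ : K ≃ₐ[F] K) (a : K) (N : ℕ) : (Fin N → K) →ₗ[F] End F K :=
  ∑ k : Fin N, LinearMap.mulRight F (skewShift σ a ^ (k : ℕ)) ∘ₗ
    (Algebra.lmul F K).toLinearMap ∘ₗ LinearMap.proj k

/-- The root bound needs a nonzero leading coefficient; `r` is the last index in the support of `f`,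
the same for all `a`. -/
theorem exists_skewEvalLinear_eq {F K : Type*} [Field F] [Field K] [Algebra F K]
    (σ : K ≃ₐ[F] K) {N s : ℕ} {f : Fin N → K} (hf : f ≠ 0) (hs : ∀ k : Fin N, s ≤ k → f k = 0) :
    ∃ (r : ℕ) (g : ℕ → K), r < s ∧ g r ≠ 0 ∧
      ∀ a, skewEvalLinear σ a N f = skewEval σ a g (r + 1) := by
  classical
  obtain ⟨k₀, hk₀⟩ := Function.ne_iff.mp hf
  obtain ⟨r, hr⟩ := (Set.toFinite {k : Fin N | f k ≠ 0}).exists_maximal ⟨k₀, hk₀⟩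
  let g : ℕ → K := fun k ↦ if h : k < N then f ⟨k, h⟩ else 0
  have hg : ∀ k : Fin N, g k = f k := fun k ↦ by simp [g]
  have hmax : ∀ k : ℕ, (r : ℕ) < k → g k = 0 := by
    intro k hk
    by_cases hN : k < N
    · by_contra h0
      have hk' : f ⟨k, hN⟩ ≠ 0 := by simpa [g, hN] using h0
      have h1 : (⟨k, hN⟩ : Fin N) ≤ r := hr.2 hk' (Fin.le_def.mpr hk.le)
      exact absurd (Fin.le_def.mp h1) (not_le.mpr hk)
    · simp [g, hN]
  refine ⟨r, g, ?_, by rw [hg]; exact hr.1, fun a ↦ ?_⟩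
  · by_contra! h
    exact hr.1 (hs r h)
  · have h1 : skewEvalLinear σ a N f =
        ∑ k : Fin N, Algebra.lmul F K (g k) * skewShift σ a ^ (k : ℕ) := by
      rw [skewEvalLinear, LinearMap.sum_apply]
      exact Finset.sum_congr rfl fun k _ ↦ by rw [hg]; rfl
    rw [h1, Fin.sum_univ_eq_sum_range (fun k ↦ Algebra.lmul F K (g k) * skewShift σ a ^ k), skewEval]
    symm
    apply Finset.sum_subset
    · exact Finset.range_subset_range.mpr (Nat.succ_le_of_lt r.isLt)
    · intro k _ hk
      rw [hmax k (Nat.lt_of_succ_le (not_lt.mp fun hlt ↦ hk (Finset.mem_range.mpr hlt))), map_zero, zero_mul]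

/-- An encoder with nested distance-optimal images: blocks up to `h` carry full-rank matrices, the
other blocks carry a linearized Reed-Solomon code. -/
theorem exists_sumRank_encoder {F : Type*} [Field F] [Fintype F] {t : ℕ} {m n : Fin t → ℕ}
    (hn : ∀ i, n i ≤ m i) (hm : ∀ i, 0 < m i) (h : Fin t) {μ : ℕ} (N : ℕ) (hμ : 0 < μ)
    (hle : ∀ i ≤ h, μ * N ≤ m i) (hlt : ∀ i, h < i → n i ≤ μ ∧ μ ≤ m i)
    (hq : t - ((h : ℕ) + 1) < Fintype.card F) :
    ∃ (K : Type) (_ : Field K) (_ : Algebra F K) (_ : FiniteDimensional F K)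
      (E : (Fin N → K) →ₗ[F] MatTuple F m n), finrank F K = μ ∧
      ∀ (s : ℕ) (f : Fin N → K), f ≠ 0 → (∀ k : Fin N, s ≤ k → f k = 0) →
        ∑ i, n i + 1 ≤ srk (E f) + s := by
  classical
  obtain ⟨K, _, _, _, _, hK⟩ := FiniteField.exists_extension_finrank_eq F hμ
  refine ⟨K, inferInstance, inferInstance, inferInstance, ?_⟩
  let σ := FiniteField.frobeniusAlgEquivOfAlgebraic F K
  -- Each block after `h` needs its own element of `Fˣ` as a norm.
  have hcard : Fintype.card {l : Fin t // h < l} ≤ Fintype.card Fˣ := by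
    have h1 : Fintype.card {l : Fin t // h < l} = t - 1 - h := by
      rw [Fintype.card_subtype, Finset.filter_lt_eq_Ioi, Fin.card_Ioi]
    rw [h1, Fintype.card_units]
    omega
  obtain ⟨u⟩ := Function.Embedding.nonempty_of_card_le hcard
  choose a ha using fun l ↦ FiniteField.norm_surjective F K (u l : F)
  have ha0 : ∀ l, a l ≠ 0 := fun l h0 ↦ (u l).ne_zero (by rw [← ha l, h0, Algebra.norm_zero])
  have hinj : Function.Injective fun l ↦ Algebra.norm F (a l) := by
    intro l l' hll
    exact u.injective (Units.ext ((ha l).symm.trans (hll.trans (ha l'))))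
  have hblock : ∀ l, ∃ φ : (Fin N → K) →ₗ[F] Matrix (Fin (m l)) (Fin (n l)) F,
      (l ≤ h → ∀ f, f ≠ 0 → n l ≤ (φ f).rank) ∧
      ∀ hl : h < l, ∀ f, n l ≤ (φ f).rank +
        finrank F (LinearMap.ker (skewEvalLinear σ (a ⟨l, hl⟩) N f)) := by
    intro l
    rcases le_or_gt l h with hl | hl
    · obtain ⟨φ, hφ⟩ := exists_linearMap_matrix_rank_eq (F := F) (V := Fin N → K) (hm l) (hn l)
        (by rw [finrank_pi_fintype]; simpa [hK, mul_comm] using hle l hl)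
      exact ⟨φ, fun _ ↦ hφ, fun hl' ↦ absurd hl' (not_lt.mpr hl)⟩
    · obtain ⟨φ, hφ⟩ := exists_linearMap_matrix_rank (skewEvalLinear σ (a ⟨l, hl⟩) N)
        (hK.symm ▸ (hlt l hl).1) (hK.symm ▸ (hlt l hl).2)
      exact ⟨φ, fun hl' ↦ absurd hl (not_lt.mpr hl'), fun _ ↦ hφ⟩
  choose φ hφ₁ hφ₂ using hblock
  refine ⟨LinearMap.pi φ, hK, fun s f hf hs ↦ ?_⟩
  obtain ⟨r, g, hrs, hgr, hev⟩ := exists_skewEvalLinear_eq σ hf hs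
  have hker := sum_finrank_ker_skewEval_le σ
    (fun x ↦ FiniteField.mem_range_algebraMap_of_frobenius_eq) a ha0 hinj r g hgr
  have h1 : ∑ l : {l // h < l}, n l ≤ ∑ l : {l // h < l}, (φ l f).rank + r := by
    refine le_trans (Finset.sum_le_sum fun l _ ↦ hφ₂ l.1 l.2 f) ?_
    rw [Finset.sum_add_distrib]
    exact Nat.add_le_add_left
      ((Finset.sum_le_sum fun l _ ↦ le_of_eq (by rw [hev])).trans hker) _
  have h2 : ∑ l : {l // ¬ h < l}, n l ≤ ∑ l : {l // ¬ h < l}, (φ l f).rank :=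
    Finset.sum_le_sum fun l _ ↦ hφ₁ l.1 (not_lt.mp l.2) f hf
  have h3 := Fintype.sum_subtype_add_sum_subtype (fun l ↦ h < l) n
  have h4 := Fintype.sum_subtype_add_sum_subtype (fun l ↦ h < l) fun l ↦ (φ l f).rank
  have h5 : srk (LinearMap.pi φ f : MatTuple F m n) = ∑ l, (φ l f).rank := rfl
  omega

/-! ### The Singleton bound -/

theorem Matrix.rank_le_card_of_col_eq_zero {F : Type*} [Field F] {p : Type*} [Finite p] {r : ℕ}
    (A : Matrix p (Fin r) F) (T : Finset (Fin r)) (hT : ∀ c ∉ T, A.col c = 0) :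
    A.rank ≤ T.card := by
  classical
  rw [A.rank_eq_finrank_span_cols]
  have hle : Submodule.span F (Set.range A.col) ≤
      Submodule.span F ((T.image A.col : Finset (p → F)) : Set (p → F)) := by
    rw [Submodule.span_le]
    rintro _ ⟨c, rfl⟩
    by_cases hc : c ∈ T
    · exact Submodule.subset_span (Finset.mem_coe.mpr (Finset.mem_image_of_mem _ hc))
    · rw [hT c hc]
      exact Submodule.zero_mem _
  exact (Submodule.finrank_mono hle).trans
    ((finrank_span_finset_le_card _).trans Finset.card_image_le)

/-- The Singleton argument: a code of dimension larger than the number of entries in a set `S` of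
columns has a nonzero codeword vanishing on these columns. -/
theorem exists_srk_add_card_le {F : Type*} [Field F] {t : ℕ} {m n : Fin t → ℕ}
    (C : Submodule F (MatTuple F m n)) (S : Finset (Σ l, Fin (n l)))
    (hS : ∑ c ∈ S, m c.1 < finrank F C) :
    ∃ X ∈ C, X ≠ 0 ∧ srk X + S.card ≤ ∑ l, n l := by
  classical
  let π : C →ₗ[F] ((c : S) → Fin (m c.1.1) → F) :=
    { toFun := fun X c r ↦ X.1 c.1.1 r c.1.2
      map_add' := fun _ _ ↦ rfl
      map_smul' := fun _ _ ↦ rfl }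
  have hlt : finrank F ((c : S) → Fin (m c.1.1) → F) < finrank F C := by
    rw [finrank_pi_fintype]
    simpa only [finrank_fin_fun, Finset.sum_coe_sort S (fun c ↦ m c.1)] using hS
  obtain ⟨X, hX, hX0⟩ := Submodule.exists_mem_ne_zero_of_ne_bot
    (LinearMap.ker_ne_bot_of_finrank_lt (f := π) hlt)
  refine ⟨X, X.2, fun h ↦ hX0 (Subtype.ext h), ?_⟩
  have hz : ∀ l c, (⟨l, c⟩ : Σ l, Fin (n l)) ∈ S → (X.1 l).col c = 0 := by
    intro l c hc
    exact congrFun (LinearMap.mem_ker.mp hX) (⟨⟨l, c⟩, hc⟩ : S)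
  let T : (l : Fin t) → Finset (Fin (n l)) := fun l ↦ {c | (⟨l, c⟩ : Σ l, Fin (n l)) ∈ S}
  have hcard : S.card = ∑ l, (T l).card := by
    rw [← Finset.card_sigma]
    congr 1
    ext ⟨l, c⟩
    simp [T]
  rw [srk, hcard, ← Finset.sum_add_distrib]
  refine Finset.sum_le_sum fun l _ ↦ ?_
  have h1 := (X.1 l).rank_le_card_of_col_eq_zero (T l)ᶜ fun c hc ↦ hz l c (by simpa [T] using hc)
  have h2 := (T l).card_compl_add_card
  rw [Fintype.card_fin] at h2
  omega

theorem minDist_eq {F : Type*} [Field F] {t : ℕ} {m n : Fin t → ℕ}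
    {C : Submodule F (MatTuple F m n)} {i : ℕ} (hle : ∀ X ∈ C, X ≠ 0 → i ≤ srk X)
    (hex : ∃ X ∈ C, X ≠ 0 ∧ srk X ≤ i) : minDist C = i := by
  obtain ⟨X, hX, hX0, hXi⟩ := hex
  have hmem : srk X ∈ {w | ∃ X ∈ C, X ≠ 0 ∧ srk X = w} := ⟨X, hX, hX0, rfl⟩
  refine le_antisymm ((Nat.sInf_le hmem).trans hXi) (le_csInf ⟨_, hmem⟩ ?_)
  rintro w ⟨Y, hY, hY0, rfl⟩
  exact hle Y hY hY0

theorem Fin.exists_eq_sum_Iio_add {t : ℕ} (n : Fin t → ℕ) {i : ℕ} (hi : 0 < i)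
    (hin : i ≤ ∑ l, n l) : ∃ (k : Fin t) (ε : ℕ), ε < n k ∧ i = ∑ l ∈ Finset.Iio k, n l + ε + 1 := by
  induction t with
  | zero => simp at hin; omega
  | succ t ih =>
    rw [Fin.sum_univ_castSucc] at hin
    by_cases hlast : i ≤ ∑ l : Fin t, n l.castSucc
    · obtain ⟨k, ε, hε, he⟩ := ih (fun l ↦ n l.castSucc) hlast
      refine ⟨k.castSucc, ε, hε, ?_⟩
      rw [← Fin.map_castSuccEmb_Iio, Finset.sum_map]
      exact he
    · refine ⟨Fin.last t, i - 1 - ∑ l : Fin t, n l.castSucc, by omega, ?_⟩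
      have : Finset.Iio (Fin.last t) = Finset.univ.map Fin.castSuccEmb := by
        ext x
        refine Fin.lastCases ?_ (fun y ↦ ?_) x <;> simp
      rw [this, Finset.sum_map]
      simp only [Fin.coe_castSuccEmb]
      omega

/-! ### Nested codes and their parameters -/

/-- Coefficient vectors of skew polynomials of degree less than `s`. -/
noncomputable def coeffsLT (F K : Type*) [Field F] [Field K] [Algebra F K] (N s : ℕ) :
    Submodule F (Fin N → K) :=
  LinearMap.ker (LinearMap.funLeft F K
    (fun i : Fin (N - s) ↦ (⟨s + i, Nat.add_lt_of_lt_sub' i.2⟩ : Fin N)))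

theorem mem_coeffsLT {F K : Type*} [Field F] [Field K] [Algebra F K] {N s : ℕ} {f : Fin N → K} :
    f ∈ coeffsLT F K N s ↔ ∀ k : Fin N, s ≤ k → f k = 0 := by
  rw [coeffsLT, LinearMap.mem_ker]
  constructor
  · intro h k hk
    have := congrFun h ⟨k - s, by omega⟩
    simpa [LinearMap.funLeft_apply, Nat.add_sub_cancel' hk] using this
  · intro h
    ext i
    exact h _ (Nat.le_add_right s i)

theorem finrank_coeffsLT {F K : Type*} [Field F] [Field K] [Algebra F K] [FiniteDimensional F K]
    {N s : ℕ} (hs : s ≤ N) : finrank F (coeffsLT F K N s) = finrank F K * s := by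
  have hsurj := LinearMap.funLeft_surjective_of_injective F K
    (fun i : Fin (N - s) ↦ (⟨s + i, Nat.add_lt_of_lt_sub' i.2⟩ : Fin N))
    (fun i i' h ↦ Fin.ext (Nat.add_left_cancel (congrArg Fin.val h)))
  have h := LinearMap.finrank_range_add_finrank_ker (LinearMap.funLeft F K
    (fun i : Fin (N - s) ↦ (⟨s + i, Nat.add_lt_of_lt_sub' i.2⟩ : Fin N)))
  rw [LinearMap.range_eq_top.mpr hsurj, finrank_top, finrank_pi_fintype, finrank_pi_fintype] at h
  simp only [Finset.sum_const, Finset.card_univ, Fintype.card_fin, smul_eq_mul] at h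
  change _ + finrank F (coeffsLT F K N s) = _ at h
  obtain ⟨e, rfl⟩ := Nat.exists_eq_add_of_le hs
  rw [Nat.add_sub_cancel_left, add_mul] at h
  rw [mul_comm]
  omega

theorem proposition4p12 {F : Type*} [Field F] [Fintype F]
    {t : ℕ} (ht : 0 < t) (m n : Fin t → ℕ)
    (hm : Antitone m) (hn : ∀ i, 0 < n i) (hnm : ∀ i, n i ≤ m i)
    (j : Fin t) (hj : IsLeast {i : Fin t | m i = m ⟨t - 1, Nat.sub_one_lt_of_lt ht⟩} j)
    (δ : ℕ) (hδ : δ < n j)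
    (d : ℕ) (hd : d = (∑ i ∈ Finset.Iio j, n i) + δ + 1)
    (h : Fin t) (hh : IsGreatest {i : Fin t | m ⟨t - 1, Nat.sub_one_lt_of_lt ht⟩ < n i} h)
    (hmh : m ⟨t - 1, Nat.sub_one_lt_of_lt ht⟩ * ((∑ i ∈ Finset.Ici j, n i) - δ) ≤ m h)
    -- blocks are numbered from 0 here, so the one-based index of the block `h` is `h + 1`
    (hq : t - ((h : ℕ) + 1) < Fintype.card F) :
    ∃ C : ℕ → Submodule F (MatTuple F m n),
      (∀ i, d ≤ i → i ≤ ∑ l, n l → IsMSRD (C i) ∧ minDist (C i) = i) ∧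
      (∀ i k, d ≤ i → i ≤ k → k ≤ ∑ l, n l → C k ≤ C i) := by
  classical
  have hmpos : ∀ i, 0 < m i := fun i ↦ (hn i).trans_le (hnm i)
  have hlast : ∀ i : Fin t, i ≤ ⟨t - 1, Nat.sub_one_lt_of_lt ht⟩ := fun i ↦
    Fin.le_def.mpr (Nat.le_sub_one_of_lt i.2)
  set μ := m ⟨t - 1, Nat.sub_one_lt_of_lt ht⟩ with hμ
  set N := (∑ i ∈ Finset.Ici j, n i) - δ with hN
  have hmj : ∀ i, j ≤ i → m i = μ := fun i hi ↦
    le_antisymm ((hm hi).trans hj.1.le) (hm (hlast i))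
  have hsplit : ∀ k : Fin t, ∑ i ∈ Finset.Iio k, n i + ∑ i ∈ Finset.Ici k, n i = ∑ i, n i := by
    intro k
    rw [← Finset.sum_add_sum_compl (Finset.Iio k)]
    congr 2
    ext x
    simp
  obtain ⟨K, _, _, _, E, hK, hE⟩ := exists_sumRank_encoder (F := F) hnm hmpos h N (hmpos _)
    (fun i hi ↦ hmh.trans (hm hi))
    (fun i hi ↦ ⟨not_lt.mp fun hlt ↦ not_lt.mpr (hh.2 hlt) hi, hm (hlast i)⟩) hq
  have hEinj : Function.Injective E := by
    rw [injective_iff_map_eq_zero]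
    intro f hf
    by_contra hf0
    -- With `s = N ≤ n` the weight bound is positive, so a nonzero message cannot be sent to zero.
    have h1 := hE N f hf0 fun k hk ↦ absurd k.2 (not_lt.mpr hk)
    have h2 : srk (E f) = 0 := by rw [hf]; simp [srk]
    have h3 := hsplit j
    omega
  refine ⟨fun i ↦ (coeffsLT F K N (∑ l, n l - i + 1)).map E, fun i hdi hi ↦ ?_,
    fun i k _ hik _ ↦ Submodule.map_mono fun f hf ↦ mem_coeffsLT.mpr fun c hc ↦
      mem_coeffsLT.mp hf c (by omega)⟩
  set s := ∑ l, n l - i + 1 with hs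
  have hsj := hsplit j
  -- Since `d + N = n + 1`, this is `d ≤ i`.
  have hsN : s ≤ N := by omega
  have hfin : finrank F ((coeffsLT F K N s).map E) = μ * s := by
    rw [← (Submodule.equivMapOfInjective E hEinj _).finrank_eq, finrank_coeffsLT hsN, hK]
  have hmin : minDist ((coeffsLT F K N s).map E) = i := by
    refine minDist_eq ?_ ?_
    · rintro _ ⟨f, hf, rfl⟩ hf0
      have := hE s f (fun h0 ↦ hf0 (by rw [h0, map_zero])) (mem_coeffsLT.mp hf)
      omega
    -- All columns in blocks from `j` on have height `μ`. Any `n - i` of them hold `(n - i)μ`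
    -- entries, fewer than the dimension `(n - i + 1)μ`.
    · obtain ⟨S, hSsub, hScard⟩ := Finset.exists_subset_card_eq
        (s := (Finset.Ici j).sigma fun l ↦ (Finset.univ : Finset (Fin (n l))))
        (n := ∑ l, n l - i) (by rw [Finset.card_sigma]; simp; omega)
      have hsum : ∑ c ∈ S, m c.1 = (∑ l, n l - i) * μ := by
        rw [← hScard, ← smul_eq_mul, ← Finset.sum_const]
        exact Finset.sum_congr rfl fun c hc ↦ hmj _ (by simpa using hSsub hc)
      obtain ⟨X, hX, hX0, hXs⟩ := exists_srk_add_card_le ((coeffsLT F K N s).map E) S (by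
        rw [hsum, hfin, hs, mul_comm]
        exact Nat.mul_lt_mul_of_pos_left (Nat.lt_succ_self _) (hmpos _))
      exact ⟨X, hX, hX0, by omega⟩
  refine ⟨⟨fun hbot ↦ ?_, ?_⟩, hmin⟩
  · rw [show (coeffsLT F K N s).map E = ⊥ from hbot, finrank_bot] at hfin
    exact absurd hfin (Nat.mul_pos (hmpos _) (Nat.succ_pos _)).ne
  obtain ⟨k, ε, hε, he⟩ := Fin.exists_eq_sum_Iio_add n (by omega) hi
  -- A smaller `k` would give `i ≤ n_1 + ⋯ + n_{j-1} < d`. From `j` on all heights are `μ`, which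
  -- yields the MSRD dimension.
  have hjk : j ≤ k := by
    by_contra! hkj
    have h1 : ∑ l ∈ Finset.Iio k, n l + n k ≤ ∑ l ∈ Finset.Iio j, n l := by
      rw [add_comm, ← Finset.sum_insert (by simp)]
      exact Finset.sum_le_sum_of_subset fun x hx ↦ by
        rcases Finset.mem_insert.mp hx with rfl | hx
        · simpa using hkj
        · simpa using (Finset.mem_Iio.mp hx).trans hkj
    omega
  refine ⟨k, ε, hε, hmin.trans he, ?_⟩
  have hsk := hsplit k
  have h2 : ∑ l ∈ Finset.Ici k, m l * n l = μ * ∑ l ∈ Finset.Ici k, n l := by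
    rw [Finset.mul_sum]
    exact Finset.sum_congr rfl fun l hl ↦ by rw [hmj l (hjk.trans (Finset.mem_Ici.mp hl))]
  rw [hfin, h2, hmj k hjk, mul_comm ε, ← mul_add]
  congr 1
  omega
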